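/- For all integers $d \ge 1$ and $w \ge 0$ there exist $\delta > 0$ and a continuous, strictly increasing function $\Psi : [0,1] \to \mathbb{R}$, depending only on $d$ and $w$, with $\Psi(0) = 3-\delta$, $\Psi(1) = 3$ and $\Psi(\alpha) < 3$ for $0 \le \alpha < 1$, such that the following holds. Let $\mathbb{F}$ be a finite field of characteristic different from $2$, let $A$ be a symmetric $(d-1)\times(d-1)$ matrix over $\mathbb{F}$ of full rank, put $x \circ y = x^{T} A y$ and $Q(x) = x \circ x$, and let $\mathcal{S} = \{(x, x\circ x) : x \in \mathbb{F}^{d-1}\} \subseteq \mathbb{F}^{d}$ be the associated non-degenerate quadratic surface of dimension $d$. Assume that $Q$ has Witt index $w$, that is, $w$ is the largest dimension of a linear subspace of $\mathbb{F}^{d-1}$ on which $Q$ vanishes identically (a totally isotropic subspace). A totally isotropic affine subspace of $\mathbb{F}^{d-1}$ is a translate $t+V$ of a totally isotropic linear subspace $V$; it is maximal if it is not properly contained in another one. For $E \subseteq \mathcal{S}$ and $j \subseteq \mathbb{F}^{d-1}$, let $|E \cap j|$ denote the number of points $(x, x\circ x) \in E$ with $x \in j$. If $\alpha \in [0,1]$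 and $E \subseteq \mathcal{S}$ satisfies $|E \cap j| \le |E|^{\alpha}$ for every maximal totally isotropic affine subspace $j$ of $\mathbb{F}^{d-1}$, then the additive energy $$\Lambda(E) = \bigl|\{(a,b,c,e) \in E^4 : a+b = c+e\}\bigr|$$ satisfies $\Lambda(E) \le |E|^{\Psi(\alpha)}$. -/

import Mathlib

open scoped Matrix

namespace QuadSurf

variable {F : Type*} [Field F] {n : ℕ}

/-- The bilinear form `x ∘ y = xᵀ A y` of a matrix `A`. -/
def circ (A : Matrix (Fin n) (Fin n) F) (x y : Fin n → F) : F := x ⬝ᵥ (A *ᵥ y)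

/-- The quadratic form `Q(x) = x ∘ x` attached to `A` is non-degenerate:
`A` is symmetric and has full rank. -/
def Nondegenerate (A : Matrix (Fin n) (Fin n) F) : Prop := A.IsSymm ∧ A.rank = n

/-- The quadratic surface `{(x, x ∘ x)} ⊆ F ^ n × F`, whose dimension is, by convention,
`d = n + 1`. -/
def surface (A : Matrix (Fin n) (Fin n) F) : Set ((Fin n → F) × F) :=
  {p | p.2 = circ A p.1 p.1}

/-- A linear subspace on which the quadratic form vanishes identically. -/
def IsTotallyIsotropic (A : Matrix (Fin n) (Fin n) F) (V : Submodule F (Fin n → F)) : Prop :=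
  ∀ v ∈ V, circ A v v = 0

/-- The Witt index: the maximal dimension of a totally isotropic linear subspace. -/
noncomputable def wittIndex (A : Matrix (Fin n) (Fin n) F) : ℕ :=
  sSup {k | ∃ V : Submodule F (Fin n → F), IsTotallyIsotropic A V ∧ Module.finrank F V = k}

/-- The supremum in the definition of the Witt index is attained. -/
theorem isGreatest_wittIndex (A : Matrix (Fin n) (Fin n) F) :
    IsGreatest {k | ∃ V : Submodule F (Fin n → F), IsTotallyIsotropic A V ∧
      Module.finrank F V = k} (wittIndex A) := by
  have hb : BddAbove {k | ∃ V : Submodule F (Fin n → F), IsTotallyIsotropic A V ∧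
      Module.finrank F V = k} := by
    refine ⟨n, ?_⟩
    rintro k ⟨V, -, rfl⟩
    simpa using Submodule.finrank_le V
  refine ⟨Nat.sSup_mem ⟨0, ⊥, ?_, by simp⟩ hb, fun k hk => le_csSup hb hk⟩
  intro v hv
  rw [Submodule.mem_bot] at hv
  simp [hv, circ]

/-- A totally isotropic affine subspace: a set `t + V` with `V` a totally isotropic
linear subspace. -/
def IsTotallyIsotropicAffine (A : Matrix (Fin n) (Fin n) F)
    (j : AffineSubspace F (Fin n → F)) : Prop :=
  (j : Set (Fin n → F)).Nonempty ∧ IsTotallyIsotropic A j.direction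

/-- A totally isotropic affine subspace that is maximal with respect to inclusion. -/
def IsMaximalTotallyIsotropicAffine (A : Matrix (Fin n) (Fin n) F)
    (j : AffineSubspace F (Fin n → F)) : Prop :=
  Maximal (IsTotallyIsotropicAffine A) j

/-- `|E ∩ j|` for a set `E` of points of the surface and a set `j ⊆ F ^ n`, the surface being
identified with `F ^ n` through its first `n` coordinates. -/
noncomputable def cardInter (E : Finset ((Fin n → F) × F))
    (j : AffineSubspace F (Fin n → F)) : ℕ :=
  {p : (Fin n → F) × F | p ∈ E ∧ p.1 ∈ j}.ncard

end QuadSurf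

/-! ### Additive energy and its fourth root. -/

namespace Finset

section Energy
variable {G : Type*} [AddCommGroup G] [DecidableEq G]

/-! A parallelogram on the surface projects to a rectangle, so the energy is at most the number of
right-angled corners (`addEnergy_le_sum_card_corner`). With `μ = |E|^(α-1)` it suffices to gain a
factor `μ^δ` over `|E|^3`.

For small `μ`, induct on the dimension of a flat containing `E`
(`energyNorm_le_of_forall_isotropic`). Rich proper subflats are peeled off; what remains in a
non-isotropic flat has few corners, and the pieces recombine because the fourth root of the energy
is subadditive (`energyNorm_union_le`).

For `μ` near 1 constant factors are not affordable. Either the energy is below `(1 - σ²)|E|^3`, or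
most of `E` lies on one isotropic flat (`exists_isotropic_of_lt_addEnergy`); then the at least `(1 -
μ)|E|` points off it spoil enough triples (`addEnergy_add_le_card_pow`). -/

lemma card_filter_sub_comm (t : Finset G) (x : G) :
    #{p ∈ t ×ˢ t | p.2 - p.1 = x} = #{p ∈ t ×ˢ t | p.1 - p.2 = x} :=
  card_bij' (fun p _ => p.swap) (fun p _ => p.swap)
    (by simp +contextual) (by simp +contextual) (by simp) (by simp)

/-- The energy is the number of triples `(a, b, c)` with `a + b - c` in the set. -/
lemma addEnergy_self_eq_card_triples (s : Finset G) :
    s.addEnergy s = #{x ∈ s ×ˢ s ×ˢ s | x.1 + x.2.1 - x.2.2 ∈ s} := by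
  rw [addEnergy]
  refine card_bij' (fun x _ => (x.1.1, x.2.1, x.1.2))
    (fun x _ => ((x.1, x.2.2), x.2.1, x.1 + x.2.1 - x.2.2)) ?_ ?_ ?_ ?_
  · rintro ⟨⟨a, c⟩, b, e⟩ h
    simp only [mem_filter, mem_product] at h ⊢
    obtain ⟨⟨⟨h1, h2⟩, h3, h4⟩, h5⟩ := h
    exact ⟨⟨h1, h3, h2⟩, by rwa [h5, add_sub_cancel_left]⟩
  · rintro ⟨a, b, c⟩ h
    simp only [mem_filter, mem_product] at h ⊢
    obtain ⟨⟨h1, h2, h3⟩, h4⟩ := h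
    exact ⟨⟨⟨h1, h3⟩, h2, h4⟩, by abel⟩
  · rintro ⟨⟨a, c⟩, b, e⟩ h
    simp only [mem_filter, mem_product] at h
    simp [h.2]
  · rintro ⟨a, b, c⟩ h
    rfl

lemma addEnergy_self_le_card_pow (s : Finset G) : s.addEnergy s ≤ #s ^ 3 := by
  rw [addEnergy_self_eq_card_triples]
  refine (card_filter_le _ _).trans ?_
  simp only [card_product]
  exact le_of_eq (by ring)

/-- The fourth root of the additive energy of a finset with itself. -/
noncomputable def energyNorm (s : Finset G) : ℝ := √√(s.addEnergy s : ℝ)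

lemma energyNorm_nonneg (s : Finset G) : 0 ≤ s.energyNorm := Real.sqrt_nonneg _

lemma energyNorm_sq (s : Finset G) : s.energyNorm ^ 2 = √(s.addEnergy s : ℝ) :=
  Real.sq_sqrt (Real.sqrt_nonneg _)

lemma energyNorm_pow_four (s : Finset G) : s.energyNorm ^ 4 = s.addEnergy s := by
  rw [show 4 = 2 * 2 from rfl, pow_mul, energyNorm_sq, Real.sq_sqrt (Nat.cast_nonneg _)]

lemma energyNorm_le_of_addEnergy_le {s : Finset G} {x : ℝ} (hx : 0 ≤ x)
    (h : (s.addEnergy s : ℝ) ≤ x ^ 4) : s.energyNorm ≤ x := by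
  rw [← energyNorm_pow_four] at h
  exact le_of_pow_le_pow_left₀ (by norm_num) hx h

lemma energyNorm_empty : (∅ : Finset G).energyNorm = 0 := by simp [energyNorm]

variable [Fintype G]

lemma addEnergy_eq_sum_card_sub_mul (s t : Finset G) :
    s.addEnergy t = ∑ x : G, #{p ∈ s ×ˢ s | p.1 - p.2 = x} * #{p ∈ t ×ˢ t | p.2 - p.1 = x} := by
  have h := card_eq_sum_card_fiberwise (f := fun x : (G × G) × G × G => x.1.1 - x.1.2)
    (s := {x ∈ ((s ×ˢ s) ×ˢ t ×ˢ t) | x.1.1 + x.2.1 = x.1.2 + x.2.2}) (t := univ)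
    (fun _ _ => by simp)
  rw [addEnergy, h]
  refine sum_congr rfl fun x _ => ?_
  rw [← card_product]
  congr 1
  ext ⟨⟨a, a'⟩, b, b'⟩
  simp only [mem_filter, mem_product]
  constructor
  · rintro ⟨⟨⟨h1, h2⟩, h3⟩, rfl⟩
    refine ⟨⟨h1, rfl⟩, h2, ?_⟩
    rw [sub_eq_sub_iff_add_eq_add, add_comm, ← h3]
  · rintro ⟨⟨h1, rfl⟩, h2, h3⟩
    refine ⟨⟨⟨h1, h2⟩, ?_⟩, rfl⟩
    rw [sub_eq_sub_iff_add_eq_add] at h3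
    rw [← h3, add_comm]

lemma addEnergy_sq_le_mul (s t : Finset G) :
    s.addEnergy t ^ 2 ≤ s.addEnergy s * t.addEnergy t := by
  simp only [addEnergy_eq_sum_card_sub_mul, card_filter_sub_comm, ← sq]
  exact sum_mul_sq_le_sq_mul_sq _ _ _

/-- Minkowski in `ℓ²`: disjointness makes the representation function of a sum additive in the first
set. -/
lemma sqrt_addEnergy_union_le {s t : Finset G} (u : Finset G) (h : Disjoint s t) :
    √((s ∪ t).addEnergy u : ℝ) ≤ √(s.addEnergy u : ℝ) + √(t.addEnergy u : ℝ) := by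
  have key (x : G) : (#{p ∈ (s ∪ t) ×ˢ u | p.1 + p.2 = x} : ℝ) =
      #{p ∈ s ×ˢ u | p.1 + p.2 = x} + #{p ∈ t ×ˢ u | p.1 + p.2 = x} := by
    rw [union_product, filter_union, card_union_of_disjoint, Nat.cast_add]
    exact disjoint_filter_filter (disjoint_product.2 (Or.inl h))
  simp only [addEnergy_eq_sum_sq, Nat.cast_sum, Nat.cast_pow, key]
  set f : G → ℝ := fun x => #{p ∈ s ×ˢ u | p.1 + p.2 = x}
  set g : G → ℝ := fun x => #{p ∈ t ×ˢ u | p.1 + p.2 = x}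
  refine Real.sqrt_le_iff.2 ⟨by positivity, ?_⟩
  have hf : 0 ≤ ∑ x, f x ^ 2 := sum_nonneg fun _ _ => sq_nonneg _
  have hg : 0 ≤ ∑ x, g x ^ 2 := sum_nonneg fun _ _ => sq_nonneg _
  have hc : ∑ x, f x * g x ≤ √(∑ x, f x ^ 2) * √(∑ x, g x ^ 2) := by
    rw [← Real.sqrt_mul hf]
    exact Real.le_sqrt_of_sq_le (sum_mul_sq_le_sq_mul_sq _ _ _)
  rw [add_sq, Real.sq_sqrt hf, Real.sq_sqrt hg]
  have : ∑ x, (f x + g x) ^ 2 = ∑ x, f x ^ 2 + 2 * ∑ x, f x * g x + ∑ x, g x ^ 2 := by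
    rw [mul_sum, ← sum_add_distrib, ← sum_add_distrib]
    exact sum_congr rfl fun x _ => by ring
  change ∑ x, (f x + g x) ^ 2 ≤ _
  linarith

lemma sqrt_addEnergy_le_mul (s t : Finset G) :
    √(s.addEnergy t : ℝ) ≤ s.energyNorm * t.energyNorm := by
  rw [energyNorm, energyNorm, ← Real.sqrt_mul (Real.sqrt_nonneg _),
    ← Real.sqrt_mul (Nat.cast_nonneg _)]
  refine Real.sqrt_le_sqrt (Real.le_sqrt_of_sq_le ?_)
  exact_mod_cast addEnergy_sq_le_mul s t

/-- Split only the first argument of the energy of the union, apply Cauchy–Schwarz to each term, and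
cancel one factor of the norm. -/
lemma energyNorm_union_le {s t : Finset G} (h : Disjoint s t) :
    (s ∪ t).energyNorm ≤ s.energyNorm + t.energyNorm := by
  rcases (energyNorm_nonneg (s ∪ t)).eq_or_lt with h0 | h0
  · rw [← h0]
    exact add_nonneg (energyNorm_nonneg _) (energyNorm_nonneg _)
  refine le_of_mul_le_mul_right ?_ h0
  rw [← sq, energyNorm_sq, add_mul]
  exact (sqrt_addEnergy_union_le _ h).trans
    (add_le_add (sqrt_addEnergy_le_mul _ _) (sqrt_addEnergy_le_mul _ _))

end Energy
end Finset

/-! ### Rectangles, flats and corners. -/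

namespace QuadSurf

section Geometry
open Finset
variable {F : Type*} [Field F] {n : ℕ} {A : Matrix (Fin n) (Fin n) F}

lemma circ_add_left (x y z : Fin n → F) : circ A (x + y) z = circ A x z + circ A y z :=
  add_dotProduct _ _ _

lemma circ_add_right (x y z : Fin n → F) : circ A x (y + z) = circ A x y + circ A x z := by
  simp [circ, Matrix.mulVec_add]

lemma circ_smul_right (t : F) (x y : Fin n → F) : circ A x (t • y) = t * circ A x y := by
  simp [circ, Matrix.mulVec_smul]

lemma circ_zero_right (x : Fin n → F) : circ A x 0 = 0 := by simp [circ]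

lemma circ_comm (hA : A.IsSymm) (x y : Fin n → F) : circ A x y = circ A y x := by
  rw [circ, circ, dotProduct_comm, Matrix.dotProduct_mulVec, ← Matrix.mulVec_transpose, hA.eq,
    dotProduct_comm, dotProduct_comm]

/-- The vectors orthogonal to every vector of `s`. -/
def orth (A : Matrix (Fin n) (Fin n) F) (s : Set (Fin n → F)) : Submodule F (Fin n → F) where
  carrier := {v | ∀ u ∈ s, circ A u v = 0}
  add_mem' hv hw u hu := by rw [circ_add_right, hv u hu, hw u hu, add_zero]
  zero_mem' u _ := circ_zero_right u
  smul_mem' t v hv u hu := by rw [circ_smul_right, hv u hu, mul_zero]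

lemma orth_span (hA : A.IsSymm) (s : Set (Fin n → F)) :
    orth A (Submodule.span F s : Set (Fin n → F)) = orth A s := by
  refine le_antisymm (fun v hv u hu => hv u (Submodule.subset_span hu)) fun v hv u hu => ?_
  have : Submodule.span F s ≤ orth A {v} := Submodule.span_le.2 fun w hw x hx => by
    rw [Set.mem_singleton_iff.1 hx, circ_comm hA]
    exact hv w hw
  rw [circ_comm hA]
  exact this hu v rfl

lemma isTotallyIsotropic_inf_orth (V : Submodule F (Fin n → F)) :
    IsTotallyIsotropic A (V ⊓ orth A V) := fun v hv => hv.2 v hv.1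

/-- A parallelogram with vertices on the surface projects to a rectangle. -/
lemma circ_sub_sub_eq_zero (hA : A.IsSymm) (h2 : (2 : F) ≠ 0) {a b c : (Fin n → F) × F}
    (ha : a ∈ surface A) (hb : b ∈ surface A) (hc : c ∈ surface A)
    (he : a + b - c ∈ surface A) : circ A (a.1 - c.1) (b.1 - c.1) = 0 := by
  obtain ⟨u, hu⟩ : ∃ u, a.1 = c.1 + u := ⟨a.1 - c.1, by abel⟩
  obtain ⟨v, hv⟩ : ∃ v, b.1 = c.1 + v := ⟨b.1 - c.1, by abel⟩
  have e1 : (a + b - c).1 = c.1 + u + v := by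
    rw [Prod.fst_sub, Prod.fst_add, hu, hv]; abel
  simp only [surface, Set.mem_ofPred_eq] at ha hb hc he
  rw [e1, Prod.snd_sub, Prod.snd_add, ha, hb, hc, hu, hv] at he
  simp only [circ_add_left, circ_add_right] at he
  rw [circ_comm hA u c.1, circ_comm hA v c.1, circ_comm hA v u] at he
  rw [hu, hv, add_sub_cancel_left, add_sub_cancel_left]
  have : 2 * circ A u v = 0 := by linear_combination -he
  exact (mul_eq_zero.1 this).resolve_left h2

open Classical in
lemma cardInter_eq (E : Finset ((Fin n → F) × F)) (j : AffineSubspace F (Fin n → F)) :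
    cardInter E j = #{p ∈ E | p.1 ∈ j} := by
  rw [cardInter, ← Set.ncard_coe_finset]
  congr 1
  ext p
  simp

lemma cardInter_mono {E E' : Finset ((Fin n → F) × F)} {j j' : AffineSubspace F (Fin n → F)}
    (hE : E ⊆ E') (hj : j ≤ j') : cardInter E j ≤ cardInter E' j' := by
  classical
  rw [cardInter_eq, cardInter_eq]
  exact card_le_card fun p hp => by
    rw [mem_filter] at hp ⊢
    exact ⟨hE hp.1, hj hp.2⟩

lemma exists_le_isMaximalTotallyIsotropicAffine [Finite F] {j : AffineSubspace F (Fin n → F)}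
    (hj : IsTotallyIsotropicAffine A j) :
    ∃ j', j ≤ j' ∧ IsMaximalTotallyIsotropicAffine A j' := by
  have : Finite (AffineSubspace F (Fin n → F)) :=
    Finite.of_injective (fun j => (j : Set (Fin n → F))) SetLike.coe_injective
  exact Finite.exists_le_maximal hj

lemma mk'_le {W : AffineSubspace F (Fin n → F)} {c : Fin n → F} (hc : c ∈ W)
    {V : Submodule F (Fin n → F)} (hV : V ≤ W.direction) : AffineSubspace.mk' c V ≤ W := by
  intro p hp
  rw [AffineSubspace.mem_mk'] at hp
  simpa using AffineSubspace.vadd_mem_of_mem_direction (hV hp) hc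

lemma mk'_lt {W : AffineSubspace F (Fin n → F)} {c : Fin n → F} (hc : c ∈ W)
    {V : Submodule F (Fin n → F)} (hV : V < W.direction) : AffineSubspace.mk' c V < W := by
  refine (mk'_le hc hV.le).lt_of_ne fun h => hV.ne ?_
  rw [← h, AffineSubspace.direction_mk']

variable [DecidableEq F]

/-- The additive energy is at most the number of right-angled corners. -/
lemma addEnergy_le_sum_card_corner (hA : A.IsSymm) (h2 : (2 : F) ≠ 0)
    {E : Finset ((Fin n → F) × F)} (hE : (E : Set ((Fin n → F) × F)) ⊆ surface A) :
    E.addEnergy E ≤ ∑ c ∈ E, ∑ a ∈ E, #{b ∈ E | circ A (a.1 - c.1) (b.1 - c.1) = 0} := by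
  have h : E.addEnergy E ≤
      #{x ∈ E ×ˢ E ×ˢ E | circ A (x.2.1.1 - x.1.1) (x.2.2.1 - x.1.1) = 0} := by
    rw [addEnergy_self_eq_card_triples]
    refine card_le_card_of_injOn (fun x => (x.2.2, x.1, x.2.1)) ?_ ?_
    · rintro ⟨a, b, c⟩ h
      simp only [mem_coe, mem_filter, mem_product] at h ⊢
      obtain ⟨⟨ha, hb, hc⟩, he⟩ := h
      exact ⟨⟨hc, ha, hb⟩, circ_sub_sub_eq_zero hA h2 (hE ha) (hE hb) (hE hc) (hE he)⟩
    · rintro ⟨a, b, c⟩ - ⟨a', b', c'⟩ - h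
      simp only [Prod.mk.injEq] at h ⊢
      exact ⟨h.2.1, h.2.2, h.1⟩
  refine h.trans (le_of_eq ?_)
  simp only [card_filter, sum_product]

/-- A set in a non-isotropic flat all of whose proper subflats are poor has small energy. -/
lemma addEnergy_le_of_forall_lt (hA : A.IsSymm) (h2 : (2 : F) ≠ 0)
    {E : Finset ((Fin n → F) × F)} (hE : (E : Set ((Fin n → F) × F)) ⊆ surface A)
    {W : AffineSubspace F (Fin n → F)} (hEW : ∀ p ∈ E, p.1 ∈ W)
    (hW : ¬ IsTotallyIsotropic A W.direction) {T : ℕ} (hT : ∀ W' < W, cardInter E W' ≤ T) :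
    E.addEnergy E ≤ 2 * T * #E ^ 2 := by
  classical
  obtain ⟨v, hv, hvv⟩ : ∃ v ∈ W.direction, circ A v v ≠ 0 := by
    simpa [IsTotallyIsotropic] using hW
  refine (addEnergy_le_sum_card_corner hA h2 hE).trans ?_
  have key : ∀ c ∈ E, ∑ a ∈ E, #{b ∈ E | circ A (a.1 - c.1) (b.1 - c.1) = 0} ≤
      #E * T + T * #E := by
    intro c hc
    -- Unless `a - c` is orthogonal to all of `W.direction`, the admissible `b` lie in a proper
    -- subflat. The exceptional `a` lie in `c` plus the radical, which is proper because of `v`.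
    have h1 : ∀ a ∈ E, #{b ∈ E | circ A (a.1 - c.1) (b.1 - c.1) = 0} ≤
        T + if a.1 - c.1 ∈ orth A W.direction then #E else 0 := by
      intro a ha
      split_ifs with h
      · exact (card_filter_le _ _).trans (Nat.le_add_left _ _)
      · have h' : ∃ u ∈ W.direction, circ A (a.1 - c.1) u ≠ 0 := by
          by_contra! h'
          exact h fun u hu => by rw [circ_comm hA, h' u hu]
        obtain ⟨u, hu, hu'⟩ := h'
        have hlt : W.direction ⊓ orth A {a.1 - c.1} < W.direction :=
          inf_le_left.lt_of_ne fun e => hu' ((e.ge hu).2 _ rfl)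
        refine le_trans ?_ ((hT _ (mk'_lt (hEW c hc) hlt)).trans (Nat.le_add_right _ _))
        rw [cardInter_eq]
        refine card_le_card fun b hb => ?_
        rw [mem_filter] at hb ⊢
        refine ⟨hb.1, ?_⟩
        rw [AffineSubspace.mem_mk']
        refine ⟨AffineSubspace.vsub_mem_direction (hEW b hb.1) (hEW c hc), fun x hx => ?_⟩
        rw [Set.mem_singleton_iff.1 hx]
        exact hb.2
    refine (sum_le_sum h1).trans ?_
    rw [sum_add_distrib, sum_const, smul_eq_mul, ← sum_filter, sum_const, smul_eq_mul]
    refine Nat.add_le_add_left (Nat.mul_le_mul_right _ ?_) _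
    have hlt : W.direction ⊓ orth A W.direction < W.direction :=
      inf_le_left.lt_of_ne fun e => hvv ((e.ge hv).2 _ hv)
    refine le_trans ?_ (hT _ (mk'_lt (hEW c hc) hlt))
    rw [cardInter_eq]
    refine card_le_card fun b hb => ?_
    rw [mem_filter] at hb ⊢
    refine ⟨hb.1, ?_⟩
    rw [AffineSubspace.mem_mk']
    exact ⟨AffineSubspace.vsub_mem_direction (hEW b hb.1) (hEW c hc), hb.2⟩
  refine (sum_le_sum key).trans (le_of_eq ?_)
  rw [sum_const, smul_eq_mul]
  ring

end Geometry
end QuadSurf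

/-! ### Few points on isotropic flats: induction on dimension. -/

namespace QuadSurf

section Decomposition
open Finset
variable {F : Type*} [Field F] [DecidableEq F] {n : ℕ} {A : Matrix (Fin n) (Fin n) F}

/-- Peeling off rich proper subflats of `W` one at a time. -/
lemma energyNorm_le_of_peel [Fintype F] {W : AffineSubspace F (Fin n → F)} {T B R : ℝ}
    (hB0 : 0 ≤ B) (hR0 : 0 ≤ R) (m : ℕ) : ∀ E : Finset ((Fin n → F) × F), (#E : ℝ) ≤ m * T →
    (∀ E' ⊆ E, ∀ W' < W, (∀ p ∈ E', p.1 ∈ W') → E'.energyNorm ≤ B) →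
    (∀ E' ⊆ E, (∀ W' < W, (cardInter E' W' : ℝ) ≤ T) → E'.energyNorm ≤ R) →
    E.energyNorm ≤ m * B + R := by
  classical
  induction m with
  | zero =>
    intro E hE _ _
    have : E = ∅ := by
      rw [← card_eq_zero]
      have : (#E : ℝ) ≤ 0 := by simpa using hE
      exact_mod_cast le_antisymm this (Nat.cast_nonneg _)
    simpa [this, energyNorm_empty] using hR0
  | succ m ih =>
    intro E hE hB hR
    by_cases h : ∀ W' < W, (cardInter E W' : ℝ) ≤ T
    · exact (hR E subset_rfl h).trans (le_add_of_nonneg_left (by positivity))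
    push Not at h
    obtain ⟨W', hW', hT⟩ := h
    rw [cardInter_eq] at hT
    have hcard : (#{p ∈ E | p.1 ∈ W'} : ℝ) + #{p ∈ E | p.1 ∉ W'} = #E := by
      exact_mod_cast card_filter_add_card_filter_not (s := E) (fun p => p.1 ∈ W')
    have hsub : {p ∈ E | p.1 ∉ W'} ⊆ E := filter_subset _ _
    have h1 := hB _ (filter_subset (fun p => p.1 ∈ W') E) W' hW' fun p hp => (mem_filter.1 hp).2
    -- The peeled piece has more than `T` points, so one unit of `m` pays for it.
    have h2 := ih {p ∈ E | p.1 ∉ W'} (by push_cast at hE; linarith)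
      (fun E' hE' => hB E' (hE'.trans hsub)) (fun E' hE' => hR E' (hE'.trans hsub))
    have h3 := energyNorm_union_le (disjoint_filter_filter_not E E (fun p => p.1 ∈ W'))
    rw [filter_union_filter_not_eq] at h3
    push_cast
    linarith

/-- About `ν^(-4)` pieces are peeled, so each may cost only `ν^5`. Hence `ν` becomes `ν^5` when the
dimension drops, which produces the exponent `2 * 5 ^ k`. Since `M ^ 4` only bounds `#E`, the same
`M` serves for all subsets. -/
lemma energyNorm_le_of_forall_isotropic [Fintype F] (hA : A.IsSymm) (h2 : (2 : F) ≠ 0) (k : ℕ) :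
    ∀ (E : Finset ((Fin n → F) × F)) (W : AffineSubspace F (Fin n → F)) (M ν : ℝ),
    (E : Set ((Fin n → F) × F)) ⊆ surface A → (∀ p ∈ E, p.1 ∈ W) →
    Module.finrank F W.direction < k → 0 ≤ M → 0 < ν → ν ≤ 1 → (#E : ℝ) ≤ M ^ 4 →
    (∀ j, IsTotallyIsotropicAffine A j → (cardInter E j : ℝ) ≤ ν ^ (2 * 5 ^ k) * M ^ 4) →
    E.energyNorm ≤ 4 ^ k * ν * M ^ 3 := by
  classical
  induction k with
  | zero => intro _ _ _ _ _ _ h; simp at h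
  | succ k ih =>
    intro E W M ν hE hEW hk hM hν hν1 hEM hiso
    rcases E.eq_empty_or_nonempty with rfl | ⟨p₀, hp₀⟩
    · rw [energyNorm_empty]; positivity
    have h4 : (1 : ℝ) ≤ 4 ^ k := one_le_pow₀ (by norm_num)
    have hνM : 0 ≤ ν * M ^ 3 := by positivity
    by_cases hW : IsTotallyIsotropic A W.direction
    · have hc : (#E : ℝ) ≤ ν ^ (2 * 5 ^ (k + 1)) * M ^ 4 := by
        refine le_trans (le_of_eq ?_) (hiso W ⟨⟨_, hEW p₀ hp₀⟩, hW⟩)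
        rw [cardInter_eq, filter_true_of_mem hEW]
      have hc2 : (#E : ℝ) ≤ ν ^ 2 * M ^ 4 := hc.trans <| by
        gcongr ?_ * _
        exact pow_le_pow_of_le_one hν.le hν1 (Nat.le_mul_of_pos_right _ (by positivity))
      refine (energyNorm_le_of_addEnergy_le hνM ?_).trans ?_
      · calc (E.addEnergy E : ℝ) ≤ (#E : ℝ) ^ 3 := by exact_mod_cast addEnergy_self_le_card_pow E
          _ ≤ (ν ^ 2 * M ^ 4) ^ 3 := by gcongr
          _ = ν ^ 6 * M ^ 12 := by ring
          _ ≤ ν ^ 4 * M ^ 12 := by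
            gcongr ?_ * _
            exact pow_le_pow_of_le_one hν.le hν1 (by norm_num)
          _ = (ν * M ^ 3) ^ 4 := by ring
      · rw [mul_assoc]
        exact le_mul_of_one_le_left hνM (one_le_pow₀ (by norm_num))
    -- With richness threshold `ν ^ 4 * M ^ 4`, this many peelings exhaust `E`.
    · set m := ⌈1 / ν ^ 4⌉₊ with hm
      have hν4 : 0 < ν ^ 4 := by positivity
      have hm1 : 1 ≤ m * ν ^ 4 := by
        rw [← div_le_iff₀ hν4]
        exact Nat.le_ceil _
      have hm2 : m * ν ^ 4 ≤ 2 := by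
        have h := (Nat.ceil_lt_add_one (a := 1 / ν ^ 4) (by positivity)).le
        have h' : ν ^ 4 ≤ 1 := pow_le_one₀ hν.le hν1
        calc m * ν ^ 4 ≤ (1 / ν ^ 4 + 1) * ν ^ 4 := by gcongr
          _ = 1 + ν ^ 4 := by field_simp
          _ ≤ 2 := by linarith
      have key := energyNorm_le_of_peel (W := W) (T := ν ^ 4 * M ^ 4)
        (B := 4 ^ k * ν ^ 5 * M ^ 3) (R := 2 * ν * M ^ 3) (by positivity) (by positivity) m E
        ?_ ?_ ?_
      · refine key.trans ?_
        calc m * (4 ^ k * ν ^ 5 * M ^ 3) + 2 * ν * M ^ 3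
            = (m * ν ^ 4) * (4 ^ k * (ν * M ^ 3)) + 2 * (ν * M ^ 3) := by ring
          _ ≤ 2 * (4 ^ k * (ν * M ^ 3)) + 2 * (4 ^ k * (ν * M ^ 3)) := by
            refine add_le_add (mul_le_mul_of_nonneg_right hm2 (by positivity)) ?_
            exact mul_le_mul_of_nonneg_left (le_mul_of_one_le_left hνM h4) (by norm_num)
          _ = 4 ^ (k + 1) * ν * M ^ 3 := by ring
      · calc (#E : ℝ) ≤ 1 * M ^ 4 := by rwa [one_mul]
          _ ≤ (m * ν ^ 4) * M ^ 4 := by gcongr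
          _ = _ := by ring
      · intro E' hE' W' hW' hEW'
        rcases E'.eq_empty_or_nonempty with rfl | ⟨p₁, hp₁⟩
        · rw [energyNorm_empty]; positivity
        have hlt := AffineSubspace.direction_lt_of_nonempty hW' ⟨_, hEW' p₁ hp₁⟩
        refine ih E' W' M (ν ^ 5) ((coe_subset.2 hE').trans hE) hEW' ?_ hM (by positivity)
          (pow_le_one₀ hν.le hν1) (le_trans (mod_cast card_le_card hE') hEM) fun j hj => ?_
        · exact (Submodule.finrank_lt_finrank_of_lt hlt).trans_le (Nat.lt_succ_iff.1 hk)
        · rw [← pow_mul, show 5 * (2 * 5 ^ k) = 2 * 5 ^ (k + 1) by ring]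
          exact le_trans (mod_cast cardInter_mono hE' le_rfl) (hiso j hj)
      · intro E' hE' hT
        refine energyNorm_le_of_addEnergy_le (by positivity) ?_
        have hT0 : 0 ≤ ν ^ 4 * M ^ 4 := by positivity
        have h := addEnergy_le_of_forall_lt hA h2 ((coe_subset.2 hE').trans hE)
          (fun p hp => hEW p (hE' hp)) hW (T := ⌊ν ^ 4 * M ^ 4⌋₊)
          fun W' hW' => Nat.le_floor (hT W' hW')
        have hE'M : (#E' : ℝ) ≤ M ^ 4 := le_trans (mod_cast card_le_card hE') hEM
        calc (E'.addEnergy E' : ℝ) ≤ 2 * (⌊ν ^ 4 * M ^ 4⌋₊ : ℝ) * (#E' : ℝ) ^ 2 := by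
              exact_mod_cast h
          _ ≤ 2 * (ν ^ 4 * M ^ 4) * (M ^ 4) ^ 2 := by
            gcongr
            exact Nat.floor_le hT0
          _ = 2 * (ν * M ^ 3) ^ 4 := by ring
          _ ≤ 16 * (ν * M ^ 3) ^ 4 := by gcongr; norm_num
          _ = (2 * ν * M ^ 3) ^ 4 := by ring

end Decomposition
end QuadSurf

/-! ### Near-maximal energy forces concentration. -/

namespace QuadSurf

section Concentration
open Finset
variable {F : Type*} [Field F] [DecidableEq F] {n : ℕ} {A : Matrix (Fin n) (Fin n) F}

open Classical in
/-- If `c ∉ j` and `a, b ∈ j`, then `a + b - c ∉ j`; this bounds the energy of a set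
concentrated on a flat `j`. -/
lemma addEnergy_add_le_card_pow (E : Finset ((Fin n → F) × F))
    (j : AffineSubspace F (Fin n → F)) :
    E.addEnergy E + #{p ∈ E | p.1 ∉ j} *
      (#{p ∈ E | p.1 ∈ j} * (#{p ∈ E | p.1 ∈ j} - #{p ∈ E | p.1 ∉ j})) ≤ #E ^ 3 := by
  set E₁ := {p ∈ E | p.1 ∈ j}
  set E₀ := {p ∈ E | p.1 ∉ j} with hE₀
  have htot : E.addEnergy E + #{x ∈ E ×ˢ E ×ˢ E | x.1 + x.2.1 - x.2.2 ∉ E} = #E ^ 3 := by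
    rw [addEnergy_self_eq_card_triples, card_filter_add_card_filter_not, card_product,
      card_product]
    ring
  rw [← htot]
  refine Nat.add_le_add_left ?_ _
  calc #E₀ * (#E₁ * (#E₁ - #E₀)) = ∑ c ∈ E₀, ∑ a ∈ E₁, (#E₁ - #E₀) := by
        simp only [sum_const, smul_eq_mul]
    _ ≤ ∑ c ∈ E₀, ∑ a ∈ E₁, #{b ∈ E₁ | a + b - c ∉ E} := by
        refine sum_le_sum fun c hc => sum_le_sum fun a ha => ?_
        -- These sums lie off `j`, so translation by `a - c` injects such `b` into `E₀`. If `#E₁ <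
        -- #E₀`, the truncated difference makes the bound trivial.
        have h1 : #{b ∈ E₁ | a + b - c ∈ E} ≤ #E₀ := by
          refine card_le_card_of_injOn (fun b => a + b - c) (fun b hb => ?_)
            fun b _ b' _ h => by simpa using h
          obtain ⟨hb, hE⟩ := mem_filter.1 hb
          refine mem_coe.2 (mem_filter.2 ⟨hE, fun hj => (mem_filter.1 hc).2 ?_⟩)
          have h := AffineSubspace.vadd_mem_of_mem_direction
            (AffineSubspace.vsub_mem_direction (mem_filter.1 ha).2 hj) (mem_filter.1 hb).2
          have e : (a.1 -ᵥ (a + b - c).1) +ᵥ b.1 = c.1 := by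
            rw [vsub_eq_sub, vadd_eq_add, Prod.fst_sub, Prod.fst_add]; abel
          rwa [e] at h
        have h2 := card_filter_add_card_filter_not (s := E₁) (fun b => a + b - c ∈ E)
        omega
    _ = #{x ∈ E₀ ×ˢ E₁ ×ˢ E₁ | x.2.1 + x.2.2 - x.1 ∉ E} := by
        simp only [card_filter, sum_product]
    _ ≤ _ := by
        refine card_le_card_of_injOn (fun x => (x.2.1, x.2.2, x.1)) ?_ ?_
        · rintro ⟨c, a, b⟩ h
          simp only [mem_coe, mem_filter, mem_product] at h ⊢
          obtain ⟨⟨hc, ha, hb⟩, he⟩ := h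
          exact ⟨⟨(mem_filter.1 ha).1, (mem_filter.1 hb).1, (mem_filter.1 hc).1⟩, he⟩
        · rintro ⟨c, a, b⟩ - ⟨c', a', b'⟩ - h
          simp only [Prod.mk.injEq] at h ⊢
          exact ⟨h.2.2, h.1, h.2.1⟩

/-- A set of almost maximal energy is concentrated on a totally isotropic flat. -/
lemma exists_isotropic_of_lt_addEnergy (hA : A.IsSymm) (h2 : (2 : F) ≠ 0)
    {E : Finset ((Fin n → F) × F)} (hE : (E : Set ((Fin n → F) × F)) ⊆ surface A) {σ : ℝ}
    (hσ : 0 < σ) (h : (1 - σ ^ 2) * (#E : ℝ) ^ 3 < E.addEnergy E) :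
    ∃ j, IsTotallyIsotropicAffine A j ∧ (1 - (n + 1) * σ) * #E ≤ cardInter E j := by
  classical
  have hne : E.Nonempty := by
    by_contra hne
    rw [not_nonempty_iff_eq_empty] at hne
    simp [hne] at h
  have hN : (0 : ℝ) < #E := by exact_mod_cast hne.card_pos
  -- Averaging gives a vertex `c` at which almost all pairs are orthogonal; by Markov, all but `σ *
  -- #E` points `a` are orthogonal to almost every `b`.
  obtain ⟨c, hc, hsum⟩ : ∃ c ∈ E, (1 - σ ^ 2) * (#E : ℝ) ^ 2 ≤
      ∑ a ∈ E, (#{b ∈ E | circ A (a.1 - c.1) (b.1 - c.1) = 0} : ℝ) := by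
    refine exists_le_of_sum_le hne ?_
    rw [sum_const, nsmul_eq_mul]
    refine le_trans (le_of_eq (by ring)) (h.le.trans ?_)
    exact_mod_cast addEnergy_le_sum_card_corner hA h2 hE
  set bad : (Fin n → F) × F → ℕ := fun a => #{b ∈ E | ¬ circ A (a.1 - c.1) (b.1 - c.1) = 0}
  have hbad : ∑ a ∈ E, (bad a : ℝ) ≤ σ ^ 2 * (#E : ℝ) ^ 2 := by
    have e : ∑ a ∈ E, (#{b ∈ E | circ A (a.1 - c.1) (b.1 - c.1) = 0} : ℝ) +
        ∑ a ∈ E, (bad a : ℝ) = (#E : ℝ) ^ 2 := by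
      rw [← sum_add_distrib, sq, ← nsmul_eq_mul, ← sum_const]
      refine sum_congr rfl fun a _ => ?_
      exact_mod_cast card_filter_add_card_filter_not (s := E) _
    linarith
  set E₀ := {a ∈ E | ¬ (bad a : ℝ) ≤ σ * #E}
  have hE₀ : (#E₀ : ℝ) ≤ σ * #E := by
    refine le_of_mul_le_mul_right ?_ (mul_pos hσ hN)
    calc (#E₀ : ℝ) * (σ * #E) = ∑ a ∈ E₀, σ * #E := by rw [sum_const, nsmul_eq_mul]
      _ ≤ ∑ a ∈ E₀, (bad a : ℝ) := sum_le_sum fun a ha => (not_le.1 (mem_filter.1 ha).2).le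
      _ ≤ ∑ a ∈ E, (bad a : ℝ) :=
        sum_le_sum_of_subset_of_nonneg (filter_subset _ _) fun _ _ _ => Nat.cast_nonneg _
      _ ≤ _ := hbad
      _ = _ := by ring
  set s : Set (Fin n → F) := {u | ∃ a ∈ E, (bad a : ℝ) ≤ σ * #E ∧ a.1 - c.1 = u}
  obtain ⟨t, hts, htc, hspan, -⟩ := Submodule.exists_finset_span_eq_linearIndepOn F s
  set V := Submodule.span F s
  have htn : (#t : ℝ) ≤ n := by
    rw [htc]
    exact_mod_cast (Submodule.finrank_le V).trans_eq (by simp)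
  have horth : orth A (t : Set (Fin n → F)) = orth A V := by
    rw [← orth_span hA, hspan]
  refine ⟨AffineSubspace.mk' c.1 (V ⊓ orth A V), ⟨⟨_, AffineSubspace.self_mem_mk' _ _⟩, ?_⟩, ?_⟩
  · rw [AffineSubspace.direction_mk']
    exact isTotallyIsotropic_inf_orth V
  set E₁ := t.biUnion fun u => {b ∈ E | ¬ circ A u (b.1 - c.1) = 0}
  have hE₁ : (#E₁ : ℝ) ≤ n * (σ * #E) := by
    calc (#E₁ : ℝ) ≤ ∑ u ∈ t, (#{b ∈ E | ¬ circ A u (b.1 - c.1) = 0} : ℝ) := by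
          exact_mod_cast card_biUnion_le
      _ ≤ ∑ u ∈ t, σ * #E := sum_le_sum fun u hu => by
          obtain ⟨a, -, ha, rfl⟩ := hts hu
          exact ha
      _ = #t * (σ * #E) := by rw [sum_const, nsmul_eq_mul]
      _ ≤ _ := by gcongr
  rw [cardInter_eq]
  set E₂ := {p ∈ E | p.1 ∈ AffineSubspace.mk' c.1 (V ⊓ orth A V)}
  have hcover : E ⊆ E₀ ∪ E₁ ∪ E₂ := by
    intro p hp
    by_cases h0 : p ∈ E₀
    · exact mem_union_left _ (mem_union_left _ h0)
    by_cases h1 : p ∈ E₁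
    · exact mem_union_left _ (mem_union_right _ h1)
    refine mem_union_right _ (mem_filter.2 ⟨hp, ?_⟩)
    rw [AffineSubspace.mem_mk', vsub_eq_sub]
    refine ⟨Submodule.subset_span ⟨p, hp, ?_, rfl⟩, ?_⟩
    · by_contra h'
      exact h0 (mem_filter.2 ⟨hp, h'⟩)
    · rw [SetLike.mem_coe, ← horth]
      intro u hu
      by_contra h'
      exact h1 (mem_biUnion.2 ⟨u, hu, mem_filter.2 ⟨hp, h'⟩⟩)
  have hcard : (#E : ℝ) ≤ #E₀ + #E₁ + #E₂ := by
    exact_mod_cast (card_le_card hcover).trans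
      ((card_union_le _ _).trans (Nat.add_le_add_right (card_union_le _ _) _))
  linarith

end Concentration

/-! ### The two regimes of `μ` and the conclusion. -/

section Main
open Finset

/-- Converts a saving linear in `1 - μ` into a power of `μ` away from 0, via `log μ ≥ 1 - μ⁻¹` and
`exp x ≥ 1 + x`. -/
lemma one_sub_le_rpow {μ μ₀ δ ε : ℝ} (hμ₀ : 0 < μ₀) (h : μ₀ ≤ μ) (h1 : μ ≤ 1) (hδ : 0 ≤ δ)
    (hε : δ ≤ μ₀ * ε) : 1 - ε * (1 - μ) ≤ μ ^ δ := by
  have hμ := hμ₀.trans_le h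
  have hε0 : 0 ≤ ε := nonneg_of_mul_nonneg_right (hδ.trans hε) hμ₀
  have hlog : 1 - μ⁻¹ ≤ Real.log μ := Real.one_sub_inv_le_log_of_pos hμ
  rw [Real.rpow_def_of_pos hμ]
  refine le_trans ?_ (Real.add_one_le_exp _)
  have h3 : δ * (1 - μ) ≤ ε * (1 - μ) * μ := by
    have := hε.trans (mul_le_mul_of_nonneg_right h hε0)
    nlinarith
  have h4 : δ * (μ⁻¹ - 1) ≤ ε * (1 - μ) := by
    rw [show δ * (μ⁻¹ - 1) = δ * (1 - μ) / μ by field_simp]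
    exact (div_le_iff₀ hμ).2 h3
  nlinarith

/-- If every maximal totally isotropic flat contains at most the proportion `μ` of `E`, then the
energy of `E` is smaller than the trivial bound by a factor that is a power of `μ`. -/
theorem exists_addEnergy_le_rpow_mul (n : ℕ) : ∃ δ : ℝ, 0 < δ ∧
    ∀ (F : Type*) [Field F] [Finite F] [DecidableEq F], (2 : F) ≠ 0 →
      ∀ A : Matrix (Fin n) (Fin n) F, A.IsSymm → ∀ E : Finset ((Fin n → F) × F),
        (E : Set ((Fin n → F) × F)) ⊆ surface A → ∀ μ : ℝ, 0 < μ → μ ≤ 1 →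
        (∀ j, IsMaximalTotallyIsotropicAffine A j → (cardInter E j : ℝ) ≤ μ * #E) →
        (E.addEnergy E : ℝ) ≤ μ ^ δ * (#E : ℝ) ^ 3 := by
  set p : ℕ := 2 * 5 ^ (n + 1) with hp
  have hp0 : p ≠ 0 := by positivity
  set C : ℝ := 4 ^ (n + 1) with hC
  have hC0 : 0 < C := by positivity
  set σ : ℝ := 1 / (4 * (n + 1)) with hσ
  have hσ0 : 0 < σ := by positivity
  have hσn : (n + 1) * σ = 1 / 4 := by rw [hσ]; field_simp
  have hσ1 : σ ≤ 1 / 4 := by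
    rw [← hσn]
    exact le_mul_of_one_le_left hσ0.le (by linarith [Nat.cast_nonneg (α := ℝ) n])
  -- For `ν = μ^(1/p)` this gives `C ^ 2 * ν ≤ 1`: half of the saving `ν ^ 4` absorbs `C ^ 4`, and
  -- the other half is `μ^(2/p)`.
  set μ₀ : ℝ := ((C ^ 2)⁻¹) ^ p with hμ₀
  have hμ₀0 : 0 < μ₀ := by positivity
  set δ : ℝ := min (2 / p) (μ₀ * σ ^ 2) with hδ
  have hδ0 : 0 < δ := lt_min (by positivity) (by positivity)
  refine ⟨δ, hδ0, ?_⟩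
  intro F _ _ _ h2 A hA E hE μ hμ hμ1 hmax
  have := Fintype.ofFinite F
  rcases E.eq_empty_or_nonempty with rfl | hne
  · simp
  have hN : (0 : ℝ) < #E := by exact_mod_cast hne.card_pos
  have hiso : ∀ j, IsTotallyIsotropicAffine A j → (cardInter E j : ℝ) ≤ μ * #E := by
    intro j hj
    obtain ⟨j', hjj', hj'⟩ := exists_le_isMaximalTotallyIsotropicAffine hj
    exact le_trans (mod_cast cardInter_mono subset_rfl hjj') (hmax j' hj')
  rcases le_total μ μ₀ with hle | hle
  · set ν : ℝ := μ ^ (1 / p : ℝ) with hν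
    have hν0 : 0 < ν := by positivity
    have hνp : ν ^ p = μ := by
      rw [hν, one_div, Real.rpow_inv_natCast_pow hμ.le hp0]
    have hν1 : ν ≤ 1 := Real.rpow_le_one hμ.le hμ1 (by positivity)
    set M : ℝ := √√(#E : ℝ) with hM
    have hM4 : M ^ 4 = #E := by
      rw [show 4 = 2 * 2 from rfl, pow_mul, hM, Real.sq_sqrt (Real.sqrt_nonneg _),
        Real.sq_sqrt hN.le]
    have key := energyNorm_le_of_forall_isotropic hA h2 (n + 1) E ⊤ M ν hE (by simp)
      (Nat.lt_succ_iff.2 ((Submodule.finrank_le _).trans_eq (by simp))) (Real.sqrt_nonneg _) hν0 hν1 hM4.ge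
      (by rw [← hp, hνp, hM4]; exact hiso)
    have hνC : C ^ 2 * ν ≤ 1 := by
      have : ν ≤ (C ^ 2)⁻¹ := by
        refine le_of_pow_le_pow_left₀ hp0 (by positivity) ?_
        rwa [hνp]
      calc C ^ 2 * ν ≤ C ^ 2 * (C ^ 2)⁻¹ := by gcongr
        _ = 1 := mul_inv_cancel₀ (by positivity)
    have hν2 : ν ^ 2 ≤ μ ^ δ := by
      rw [hν, ← Real.rpow_natCast, ← Real.rpow_mul hμ.le]
      refine Real.rpow_le_rpow_of_exponent_ge hμ hμ1 ((min_le_left _ _).trans (le_of_eq ?_))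
      push_cast
      ring
    calc (E.addEnergy E : ℝ) = E.energyNorm ^ 4 := (energyNorm_pow_four E).symm
      _ ≤ (C * ν * M ^ 3) ^ 4 := by
        gcongr
        exact energyNorm_nonneg E
      _ = (C ^ 2 * ν) ^ 2 * ν ^ 2 * (M ^ 4) ^ 3 := by ring
      _ ≤ 1 * μ ^ δ * (#E : ℝ) ^ 3 := by
        rw [hM4]
        gcongr
        exact pow_le_one₀ (by positivity) hνC
      _ = _ := by rw [one_mul]
  · have hrpow := one_sub_le_rpow hμ₀0 hle hμ1 hδ0.le (min_le_right _ _)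
    rcases le_or_gt (E.addEnergy E : ℝ) ((1 - σ ^ 2) * (#E : ℝ) ^ 3) with hlow | hhigh
    · refine hlow.trans ?_
      gcongr
      nlinarith
    · obtain ⟨j, hj, hcard⟩ := exists_isotropic_of_lt_addEnergy hA h2 hE hσ0 hhigh
      classical
      have hsub := hiso j hj
      rw [hσn] at hcard
      have hen := addEnergy_add_le_card_pow E j
      have htot := card_filter_add_card_filter_not (s := E) (fun p => p.1 ∈ j)
      rw [cardInter_eq] at hsub hcard
      set x := #{p ∈ E | p.1 ∈ j}
      set y := #{p ∈ E | p.1 ∉ j}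
      have htot' : (x : ℝ) + y = #E := by exact_mod_cast htot
      have hyx : y ≤ x := by
        have : (y : ℝ) ≤ x := by linarith
        exact_mod_cast this
      have hen' : (E.addEnergy E : ℝ) + y * (x * (x - y)) ≤ (#E : ℝ) ^ 3 := by
        rw [← Nat.cast_sub hyx]
        exact_mod_cast hen
      have h1 : (1 - μ) * #E ≤ y := by linarith
      -- By the choice of `σ`, at least three quarters of `E` lie on `j`.
      have h3 : (3 / 4 : ℝ) * #E * (1 / 2 * #E) ≤ x * (x - y) := by
        gcongr <;> linarith
      have h4 : (1 - μ) * #E * ((3 / 4 : ℝ) * #E * (1 / 2 * #E)) ≤ y * (x * (x - y)) :=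
        mul_le_mul h1 h3 (by positivity) (Nat.cast_nonneg _)
      calc (E.addEnergy E : ℝ) ≤ (1 - 3 / 8 * (1 - μ)) * (#E : ℝ) ^ 3 := by linarith
        _ ≤ (1 - σ ^ 2 * (1 - μ)) * (#E : ℝ) ^ 3 := by
          gcongr
          nlinarith
        _ ≤ _ := by gcongr

end Main
end QuadSurf

theorem mainTheorem7 (d w : ℕ) (hd : 1 ≤ d) :
    ∃ (Ψ : ℝ → ℝ) (δ : ℝ), 0 < δ ∧
      ContinuousOn Ψ (Set.Icc 0 1) ∧ StrictMonoOn Ψ (Set.Icc 0 1) ∧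
      Ψ 0 = 3 - δ ∧ Ψ 1 = 3 ∧ (∀ α ∈ Set.Ico (0 : ℝ) 1, Ψ α < 3) ∧
      ∀ (F : Type*) [Field F] [Finite F] [DecidableEq F], ringChar F ≠ 2 →
        ∀ A : Matrix (Fin (d - 1)) (Fin (d - 1)) F,
          QuadSurf.Nondegenerate A → QuadSurf.wittIndex A = w →
          ∀ α ∈ Set.Icc (0 : ℝ) 1, ∀ E : Finset ((Fin (d - 1) → F) × F),
            (E : Set ((Fin (d - 1) → F) × F)) ⊆ QuadSurf.surface A →
            (∀ j : AffineSubspace F (Fin (d - 1) → F),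
              QuadSurf.IsMaximalTotallyIsotropicAffine A j →
                (QuadSurf.cardInter E j : ℝ) ≤ (E.card : ℝ) ^ α) →
            (Finset.addEnergy E E : ℝ) ≤ (E.card : ℝ) ^ Ψ α := by
  obtain ⟨δ, hδ, h⟩ := QuadSurf.exists_addEnergy_le_rpow_mul (d - 1)
  -- The factor `μ^δ` with `μ = |E|^(α-1)` makes the exponent affine in `α`.
  refine ⟨fun α => 3 - δ * (1 - α), δ, hδ, by fun_prop, ?_, by ring, by ring, ?_, ?_⟩
  · intro a _ b _ hab
    have := mul_lt_mul_of_pos_left hab hδ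
    dsimp only
    linarith
  · intro α hα
    have := mul_pos hδ (sub_pos.2 hα.2)
    dsimp only
    linarith
  · intro F _ _ _ hchar A hA _ α hα E hE hmax
    rcases E.eq_empty_or_nonempty with rfl | hne
    · rw [Finset.addEnergy_empty_left, Nat.cast_zero]
      positivity
    have hN1 : (1 : ℝ) ≤ E.card := by exact_mod_cast hne.card_pos
    have hN : (0 : ℝ) < E.card := by linarith
    have key := h F (Ring.two_ne_zero hchar) A hA.1 E hE ((E.card : ℝ) ^ (α - 1))
      (by positivity) (Real.rpow_le_one_of_one_le_of_nonpos hN1 (by linarith [hα.2]))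
      fun j hj => (hmax j hj).trans_eq <| by
        rw [Real.rpow_sub_one hN.ne', div_mul_cancel₀ _ hN.ne']
    refine key.trans_eq ?_
    rw [← Real.rpow_mul hN.le, ← Real.rpow_natCast, ← Real.rpow_add hN]
    congr 1
    push_cast
    ring
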